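/- **Theorem 1.3.** Let $n\in\mathbb N$, $S=\mathbb R[x_0,\dots,x_n]$, and let $X\subseteq\mathbb P^n=\operatorname{Proj}(S)$ be a real projective subvariety (a reduced closed subscheme over $\mathbb R$) that is * irreducible; * non-degenerate: $X$ is not contained in a hyperplane; * totally real: the set $X(\mathbb R)$ of real points is Zariski dense in the set $X(\mathbb C)$ of complex points. Let $I_X\subseteq S$ be the saturated homogeneous ideal of $X$ and $R=S/I_X$ its homogeneous coordinate ring. The Pythagoras number $\operatorname{py}(X)$ is the smallest $r\in\mathbb N$ such that every element of $R_2$ that is a sum of finitely many squares of elements of $R_1$ is a sum of $r$ squares of elements of $R_1$. The quadratic persistence $\operatorname{qp}(X)$ is the smallest $k\in\mathbb N$ for which there is a set $\Gamma$ of $k$ closed points of the complexification $X_{\mathbb C}$ (that is, $\Gamma\subseteq X(\mathbb C)$ with $|\Gamma|=k$) such that, for the linear projection $\pi_\Gamma$ away from the linear span of $\Gamma$, the homogeneous ideal of the image $\pi_\Gamma(X_{\mathbb C})$ contains no nonzero quadratic form. Then $$\operatorname{py}(X)\;\geqslant\; n+1-\operatorname{qp}(X)\;\geqslant\; 1+\dim(X).$$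 -/

import Mathlib

open MvPolynomial
open scoped LinearAlgebra.Projectivization

noncomputable section

attribute [local instance] MvPolynomial.gradedAlgebra

namespace PythagorasQP

/-! ### Real projective subvarieties

Projective space over `ℝ` is `Proj S` for `S = ℝ[x₀, …, xₙ]` with its standard grading. A reduced
closed subscheme is determined by its underlying closed set, so a real projective subvariety is a
closed subset of the projective spectrum of `S`. It need not be irreducible. -/

/-- The underlying space of real projective space `ℙⁿ = Proj ℝ[x₀, …, xₙ]`. -/
abbrev RealProj (n : ℕ) : Type :=
  ProjectiveSpectrum (homogeneousSubmodule (Fin (n + 1)) ℝ)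

/-- The saturated homogeneous ideal `I_X ⊆ ℝ[x₀, …, xₙ]` of `X`: the intersection of the homogeneous
primes that are points of `X`. -/
def idealOf {n : ℕ} (X : Set (RealProj n)) : Ideal (MvPolynomial (Fin (n + 1)) ℝ) :=
  (ProjectiveSpectrum.vanishingIdeal X).toIdeal

/-- `X` is non-degenerate: it is not contained in a hyperplane. -/
def IsNondegenerate {n : ℕ} (X : Set (RealProj n)) : Prop :=
  ∀ l : MvPolynomial (Fin (n + 1)) ℝ, l.IsHomogeneous 1 → l ≠ 0 →
    ¬ X ⊆ ProjectiveSpectrum.zeroLocus (homogeneousSubmodule (Fin (n + 1)) ℝ) {l}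

/-- The set `X(ℂ)` of complex points, that is, the set of closed points of the complexification
`X_ℂ = X ×_ℝ ℂ`: the points of complex projective space at which all elements of `I_X` vanish. As
`I_X` is homogeneous, the condition does not depend on the representative. -/
def complexPoints {n : ℕ} (X : Set (RealProj n)) : Set (ℙ ℂ (Fin (n + 1) → ℂ)) :=
  {p | ∀ f ∈ idealOf X, aeval p.rep f = 0}

/-- The set `X(ℝ)` of real points, as a subset of `X(ℂ)`: the complex points that are represented
by a real vector. -/
def realPoints {n : ℕ} (X : Set (RealProj n)) : Set (ℙ ℂ (Fin (n + 1) → ℂ)) :=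
  {p | p ∈ complexPoints X ∧
    ∃ (v : Fin (n + 1) → ℂ) (hv : v ≠ 0), (∀ i, (v i).im = 0) ∧ Projectivization.mk ℂ v hv = p}

/-! ### Subsets of complex projective space -/

/-- The saturated homogeneous ideal of a subset `Z` of complex projective space with `m` homogeneous
coordinates: the polynomials that vanish at every representative of every point of `Z`. (It is the
unit ideal if `Z` is empty. The ideals of `Z` and of its Zariski closure agree.) -/
def projIdeal {m : ℕ} (Z : Set (ℙ ℂ (Fin m → ℂ))) : Ideal (MvPolynomial (Fin m) ℂ) where
  carrier := {f | ∀ (v : Fin m → ℂ) (hv : v ≠ 0), Projectivization.mk ℂ v hv ∈ Z → eval v f = 0}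
  add_mem' := by
    intro f g hf hg v hv hZ
    rw [map_add, hf v hv hZ, hg v hv hZ, add_zero]
  zero_mem' := by
    intro v hv hZ
    exact map_zero _
  smul_mem' := by
    intro c f hf v hv hZ
    rw [smul_eq_mul, map_mul, hf v hv hZ, mul_zero]

/-- `X` is totally real: `X(ℝ)` is Zariski dense in `X(ℂ)`, i.e. every polynomial that vanishes on
`X(ℝ)` vanishes on `X(ℂ)`. -/
def IsTotallyReal {n : ℕ} (X : Set (RealProj n)) : Prop :=
  projIdeal (realPoints X) ≤ projIdeal (complexPoints X)

/-- The image of `Y` under the linear projection `[v] ↦ [L v]`, a rational map that is defined away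
from the linear subspace `ker L`. -/
def projImage {n m : ℕ} (L : (Fin (n + 1) → ℂ) →ₗ[ℂ] (Fin m → ℂ))
    (Y : Set (ℙ ℂ (Fin (n + 1) → ℂ))) : Set (ℙ ℂ (Fin m → ℂ)) :=
  {q | ∃ (v : Fin (n + 1) → ℂ) (hv : v ≠ 0) (hL : L v ≠ 0),
    Projectivization.mk ℂ v hv ∈ Y ∧ Projectivization.mk ℂ (L v) hL = q}

/-- `L` is a linear projection away from `Γ`: a surjective linear map whose kernel is the linear
span of `Γ`. Such an `L` exists and is unique up to a linear change of coordinates on the target. -/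
def IsProjectionAway {n m : ℕ} (Γ : Finset (ℙ ℂ (Fin (n + 1) → ℂ)))
    (L : (Fin (n + 1) → ℂ) →ₗ[ℂ] (Fin m → ℂ)) : Prop :=
  Function.Surjective L ∧ LinearMap.ker L = ⨆ p ∈ Γ, p.submodule

/-- The quadratic persistence of a complex projective subvariety with set of closed points `Y`: the
smallest `k` for which there is a set `Γ` of `k` closed points of `Y` such that the homogeneous
ideal of the image of `Y` under the projection away from `Γ` contains no (nonzero) quadratic
form. -/
def quadraticPersistence {n : ℕ} (Y : Set (ℙ ℂ (Fin (n + 1) → ℂ))) : ℕ :=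
  sInf {k : ℕ | ∃ Γ : Finset (ℙ ℂ (Fin (n + 1) → ℂ)), (Γ : Set (ℙ ℂ (Fin (n + 1) → ℂ))) ⊆ Y ∧
    Γ.card = k ∧
    ∃ (m : ℕ) (L : (Fin (n + 1) → ℂ) →ₗ[ℂ] (Fin m → ℂ)), IsProjectionAway Γ L ∧
      ∀ f ∈ projIdeal (projImage L Y), f.IsHomogeneous 2 → f = 0}

/-! ### Sums of squares -/

/-- The homogeneous coordinate ring `R = S / I_X`. -/
abbrev CoordRing {n : ℕ} (X : Set (RealProj n)) : Type :=
  MvPolynomial (Fin (n + 1)) ℝ ⧸ idealOf X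

/-- The graded piece `R_d` of the homogeneous coordinate ring. -/
def gradedPiece {n : ℕ} (X : Set (RealProj n)) (d : ℕ) : Submodule ℝ (CoordRing X) :=
  (homogeneousSubmodule (Fin (n + 1)) ℝ d).map (Ideal.Quotient.mkₐ ℝ (idealOf X)).toLinearMap

/-- The cone of sums of squares of linear forms in `R₂`. -/
def sosCone {n : ℕ} (X : Set (RealProj n)) : Set (CoordRing X) :=
  {f | f ∈ gradedPiece X 2 ∧
    ∃ (r : ℕ) (g : Fin r → CoordRing X), (∀ i, g i ∈ gradedPiece X 1) ∧ f = ∑ i, g i ^ 2}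

/-- The Pythagoras number of `X`: the smallest `r` such that every element of the sums-of-squares
cone is a sum of `r` squares of elements of `R₁`. -/
def pythagorasNumber {n : ℕ} (X : Set (RealProj n)) : ℕ :=
  sInf {r : ℕ | ∀ f ∈ sosCone X,
    ∃ g : Fin r → CoordRing X, (∀ i, g i ∈ gradedPiece X 1) ∧ f = ∑ i, g i ^ 2}

end PythagorasQP

end

noncomputable section

attribute [local instance] MvPolynomial.gradedAlgebra

namespace PythagorasQP

/-! ### Directional derivatives of polynomials -/

section DirDeriv

variable {σ K : Type*} [Field K]

/-! Both inequalities come from projecting away from points of `X`, and total reality lets these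
points be real.

Upper bound for the quadratic persistence. The real points span, since a linear form vanishing on
them would lie in `I_X`. Suppose `R` is algebraic over the linear forms vanishing on `W`, the span
of the points chosen so far, but coordinates on the quotient by `W` are algebraically dependent in
`R`. In characteristic zero, some derivative of a relation of least degree along a spanning real
point is nonzero in `R`, so projecting from that point too keeps `R` algebraic over the remaining
forms (`AlgebraicOverForms.exists_sup`). This stops after `k` independent points, when the remaining
`m = n + 1 - k` coordinates are algebraically independent. Then the image lies on no hypersurface at
all, and `dim X + 1 ≤ dim R ≤ m`.

Lower bound for the Pythagoras number. If the projection from `Γ` lies on no quadric, no nonzero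
quadric through `X_ℂ` is singular along `Γ`, because such a quadric is a cone that descends to the
target. This condition on the points is open, so they can be moved one at a time to real points
(`IsTotallyReal.exists_real_tuple`). Let `F` be the sum of squares of coordinates on the quotient by
the span of these real points. In any representation of `F` modulo `I_X` by `r` squares, each linear
form vanishes at the points. The difference is then a quadric through `X` singular there, hence
zero. So `F` itself is a sum of `r` squares, and comparing kernels gives `r ≥ n + 1 - k`
(`le_add_of_forall_sosCone`). -/

theorem pderiv_ne_zero_totalDegree_lt {i : σ} {f : MvPolynomial σ K} (h : pderiv i f ≠ 0) :
    (pderiv i f).totalDegree < f.totalDegree := by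
  classical
  have key : ∀ m ∈ (pderiv i f).support, (m.sum fun _ e => e) < f.totalDegree := by
    intro m hm
    rw [mem_support_iff, coeff_pderiv] at hm
    have := le_totalDegree (mem_support_iff.2 (left_ne_zero_of_mul hm))
    rw [Finsupp.sum_add_index' (by simp) (by simp), Finsupp.sum_single_index rfl] at this
    omega
  obtain ⟨m, hm⟩ := Finset.nonempty_iff_ne_empty.2 (mt support_eq_empty.1 h)
  exact (Finset.sup_lt_iff (lt_of_le_of_lt (Nat.zero_le _) (key m hm))).2 key

theorem eq_C_of_pderiv_eq_zero [CharZero K] {f : MvPolynomial σ K} (h : ∀ i, pderiv i f = 0) :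
    f = C (coeff 0 f) := by
  classical
  ext m
  rw [coeff_C]
  split_ifs with hm
  · rw [hm]
  · obtain ⟨i, hi⟩ : ∃ i, m i ≠ 0 := by
      by_contra! hc
      exact hm (Finsupp.ext hc).symm
    have := congrArg (coeff (m - Finsupp.single i 1)) (h i)
    rw [coeff_pderiv, coeff_zero, tsub_add_cancel_of_le
      (Finsupp.single_le_iff.2 (Nat.one_le_iff_ne_zero.2 hi))] at this
    exact (mul_eq_zero.1 this).resolve_right (by norm_cast)

variable [Fintype σ]

/-- The derivative of polynomials in the direction `v`, as a function linear in `v`. -/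
def dirDeriv : (σ → K) →ₗ[K] Derivation K (MvPolynomial σ K) (MvPolynomial σ K) where
  toFun v := ∑ i, v i • pderiv i
  map_add' u v := by simp [add_smul, Finset.sum_add_distrib]
  map_smul' c v := by simp [mul_smul, Finset.smul_sum]

theorem dirDeriv_apply (v : σ → K) (f : MvPolynomial σ K) :
    dirDeriv v f = ∑ i, v i • pderiv i f := by
  simp only [dirDeriv, LinearMap.coe_mk, AddHom.coe_mk]
  rw [← Derivation.coeFnAddMonoidHom_apply, map_sum, Finset.sum_apply]
  rfl

@[simp]
theorem dirDeriv_X (v : σ → K) (i : σ) : dirDeriv v (X i) = C (v i) := by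
  classical
  rw [dirDeriv_apply, Finset.sum_eq_single i]
  · simp [smul_eq_C_mul]
  · intro j _ hj
    rw [pderiv_X_of_ne hj.symm, smul_zero]
  · simp

theorem dirDeriv_ne_zero_totalDegree_lt {v : σ → K} {f : MvPolynomial σ K}
    (h : dirDeriv v f ≠ 0) : (dirDeriv v f).totalDegree < f.totalDegree := by
  classical
  rw [dirDeriv_apply] at h ⊢
  have hle : ∀ i, v i • pderiv i f ≠ 0 → (v i • pderiv i f).totalDegree < f.totalDegree :=
    fun i hi => (totalDegree_smul_le _ _).trans_lt
      (pderiv_ne_zero_totalDegree_lt (right_ne_zero_of_smul hi))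
  obtain ⟨i, -, hi⟩ := Finset.exists_ne_zero_of_sum_ne_zero h
  have hpos := lt_of_le_of_lt (Nat.zero_le _) (hle i hi)
  refine lt_of_le_of_lt (totalDegree_finsetSum _ _) ((Finset.sup_lt_iff hpos).2 fun j _ => ?_)
  by_cases hj : v j • pderiv j f = 0
  · rw [hj, totalDegree_zero]
    exact hpos
  · exact hle j hj

/-- Chain rule along a line. -/
theorem derivative_aeval_line {B : Type*} [CommRing B] [Algebra K B] (z : σ → B) (w : σ → K)
    (g : MvPolynomial σ K) :
    Polynomial.derivative (aeval (fun i => Polynomial.C (z i) +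
      Polynomial.C (algebraMap K B (w i)) * Polynomial.X) g) =
    aeval (fun i => Polynomial.C (z i) +
      Polynomial.C (algebraMap K B (w i)) * Polynomial.X) (dirDeriv w g) := by
  induction g using MvPolynomial.induction_on with
  | C a => simp [derivation_C, Polynomial.algebraMap_eq, IsScalarTower.algebraMap_apply K B (Polynomial B)]
  | add p q hp hq => simp only [map_add, hp, hq]
  | mul_X p i hp =>
    rw [map_mul, Polynomial.derivative_mul, hp, Derivation.leibniz, dirDeriv_X, map_add]
    simp [IsScalarTower.algebraMap_apply K B (Polynomial B)]
    ring

end DirDeriv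

/-! ### Linear forms in a domain, and successive projection -/

section Forms

/-- Transitivity of algebraic dependence, read in the algebraic matroid of `A`: a set whose closure
contains a spanning set is spanning. -/
theorem isAlgebraic_adjoin_of_forall {K A : Type*} [Field K] [CommRing A] [IsDomain A] [Algebra K A]
    {s t : Set A}
    (hs : Algebra.IsAlgebraic (Algebra.adjoin K s) A)
    (hst : ∀ a ∈ s, IsAlgebraic (Algebra.adjoin K t) a) :
    Algebra.IsAlgebraic (Algebra.adjoin K t) A := by
  rw [← AlgebraicIndependent.matroid_spanning_iff, Matroid.spanning_iff_closure_eq] at hs ⊢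
  refine (Matroid.closure_subset_ground _ _).antisymm ?_
  rw [← hs]
  refine Matroid.closure_subset_closure_of_subset_closure ?_
  rw [AlgebraicIndependent.matroid_closure_eq]
  exact hst

variable {K E A : Type*} [Field K] [AddCommGroup E] [Module K E] [CommRing A]
  [IsDomain A] [Algebra K A]

/-- All of `A` is algebraic over the subalgebra generated by the linear forms that vanish
on `W`. -/
def AlgebraicOverForms (lf : Module.Dual K E →ₗ[K] A) (W : Submodule K E) : Prop :=
  Algebra.IsAlgebraic (Algebra.adjoin K (lf '' (W.dualAnnihilator : Set (Module.Dual K E)))) A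

/-- A relation between the coordinates that genuinely involves the direction `L w` makes a form dual
to `w` algebraic over the forms that also vanish at `w`. Geometrically, projecting from `w` does not
lower the dimension of the image. -/
theorem AlgebraicOverForms.exists_sup [CharZero K] {lf : Module.Dual K E →ₗ[K] A}
    {W : Submodule K E} (hW : AlgebraicOverForms lf W) {V : Set E} (hV : Submodule.span K V = ⊤)
    {m : ℕ} {L : E →ₗ[K] (Fin m → K)} (hL : Function.Surjective L) (hker : LinearMap.ker L = W)
    (hind : ¬ AlgebraicIndependent K fun j => lf (LinearMap.proj j ∘ₗ L)) :
    ∃ w ∈ V, w ∉ W ∧ AlgebraicOverForms lf (W ⊔ Submodule.span K {w}) := by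
  classical
  set y : Fin m → A := fun j => lf (LinearMap.proj j ∘ₗ L) with hy
  have hex : ∃ d, ∃ g : MvPolynomial (Fin m) K, g ≠ 0 ∧ aeval y g = 0 ∧ g.totalDegree = d := by
    rw [algebraicIndependent_iff] at hind
    push Not at hind
    obtain ⟨g, hg, hg0⟩ := hind
    exact ⟨_, g, hg0, hg, rfl⟩
  obtain ⟨g, hg0, hg, hdeg⟩ := Nat.find_spec hex
  have hmin : ∀ q : MvPolynomial (Fin m) K, q ≠ 0 → q.totalDegree < g.totalDegree →
      aeval y q ≠ 0 := fun q hq hlt h0 => Nat.find_min hex (hdeg ▸ hlt) ⟨q, hq, h0, rfl⟩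
  -- If all these derivatives vanished, `g` would be constant because `V` spans, and a constant
  -- relation is zero.
  obtain ⟨w, hwV, hw⟩ : ∃ w ∈ V, dirDeriv (L w) g ≠ 0 := by
    by_contra! hc
    have htop : ∀ u, dirDeriv (L u) g = 0 := fun u => by
      have hu : u ∈ Submodule.span K V := hV ▸ Submodule.mem_top
      induction hu using Submodule.span_induction with
      | mem x hx => exact hc x hx
      | zero => simp
      | add a b _ _ ha hb => simp [ha, hb]
      | smul c a _ ha => simp [ha]
    have hp : ∀ i, pderiv i g = 0 := fun i => by
      obtain ⟨u, hu⟩ := hL (Pi.single i 1)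
      have := htop u
      rw [hu, dirDeriv_apply, Finset.sum_eq_single i] at this
      · simpa using this
      · intro j _ hj
        simp [hj]
      · simp
    have hC := eq_C_of_pderiv_eq_zero hp
    rw [hC] at hg hg0
    rw [aeval_C, map_eq_zero_iff _ (FaithfulSMul.algebraMap_injective K A)] at hg
    exact hg0 (by rw [hg, C_0])
  have hgw : aeval y (dirDeriv (L w) g) ≠ 0 := hmin _ hw (dirDeriv_ne_zero_totalDegree_lt hw)
  have hLw : L w ≠ 0 := fun h => hw (by simp [h])
  refine ⟨w, hwV, fun h => hLw (by rwa [← hker] at h), ?_⟩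
  obtain ⟨j, hj⟩ := Function.ne_iff.1 hLw
  set ψ : Module.Dual K E := (L w j)⁻¹ • (LinearMap.proj j ∘ₗ L) with hψ
  have hψw : ψ w = 1 := by simpa [hψ] using inv_mul_cancel₀ hj
  have hLW : ∀ i, (LinearMap.proj i ∘ₗ L : Module.Dual K E) ∈ W.dualAnnihilator := fun i => by
    rw [Submodule.mem_dualAnnihilator]
    intro u hu
    rw [← hker, LinearMap.mem_ker] at hu
    simp [hu]
  have hψW : ψ ∈ W.dualAnnihilator := Submodule.smul_mem _ _ (hLW j)
  set W' := W ⊔ Submodule.span K {w}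
  set B := Algebra.adjoin K (lf '' (W'.dualAnnihilator : Set (Module.Dual K E))) with hB
  have hmem : ∀ φ ∈ W.dualAnnihilator, lf (φ - φ w • ψ) ∈ B := fun φ hφ => by
    refine Algebra.subset_adjoin ⟨_, ?_, rfl⟩
    rw [SetLike.mem_coe, Submodule.dualAnnihilator_sup_eq]
    refine ⟨Submodule.sub_mem _ hφ (Submodule.smul_mem _ _ hψW), ?_⟩
    rw [SetLike.mem_coe, Submodule.mem_dualAnnihilator]
    intro u hu
    obtain ⟨c, rfl⟩ := Submodule.mem_span_singleton.1 hu
    simp [hψw]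
  have ht : IsAlgebraic B (lf ψ) := by
    -- Each coordinate splits as `y i = z i + (L w i) • lf ψ` with `z i` a form vanishing on `W'`,
    -- so `g` becomes a one-variable polynomial over `B` with root `lf ψ`.
    set z : Fin m → B := fun i => ⟨_, hmem _ (hLW i)⟩ with hz
    set h : Polynomial B := aeval (fun i => Polynomial.C (z i) +
      Polynomial.C (algebraMap K B (L w i)) * Polynomial.X) g with hh
    have heval : ∀ q : MvPolynomial (Fin m) K, Polynomial.aeval (lf ψ) (aeval (fun i =>
        Polynomial.C (z i) + Polynomial.C (algebraMap K B (L w i)) * Polynomial.X) q) =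
        aeval y q := fun q => by
      have := congrArg (fun F => F q) (comp_aeval (R := K) (fun i =>
        Polynomial.C (z i) + Polynomial.C (algebraMap K B (L w i)) * Polynomial.X)
        ((Polynomial.aeval (R := B) (lf ψ)).restrictScalars K))
      refine this.trans ?_
      congr 2
      funext i
      simp [hz, hy, ← IsScalarTower.algebraMap_apply, Algebra.smul_def]
    -- By the chain rule the derivative of `h` at `lf ψ` is `aeval y (dirDeriv (L w) g)`, which is
    -- nonzero by minimality of `g`; hence `h ≠ 0`.
    refine ⟨h, fun h0 => hgw ?_, by rw [hh, heval, hg]⟩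
    rw [← heval, ← derivative_aeval_line, ← hh, h0]
    simp
  refine isAlgebraic_adjoin_of_forall hW ?_
  rintro _ ⟨φ, hφ, rfl⟩
  have hsplit : lf φ = lf (φ - φ w • ψ) + algebraMap K A (φ w) * lf ψ := by
    simp [Algebra.smul_def]
  rw [hsplit]
  refine IsAlgebraic.add ?_ (IsAlgebraic.mul ?_ ht)
  · exact isAlgebraic_algebraMap (⟨_, hmem φ hφ⟩ : B)
  · exact isAlgebraic_algebraMap (⟨_, B.algebraMap_mem _⟩ : B)

/-- Successive projection from points of a spanning set `V` ends with linear forms that are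
algebraically independent and over which `A` is algebraic. -/
theorem exists_algebraicIndependent_forms [FiniteDimensional K E] [CharZero K]
    (lf : Module.Dual K E →ₗ[K] A)
    (hlf : Algebra.adjoin K (Set.range lf) = ⊤) {V : Set E} (hV : Submodule.span K V = ⊤) :
    ∃ (k : ℕ) (v : Fin k → E), LinearIndependent K v ∧ (∀ i, v i ∈ V) ∧
      AlgebraicOverForms lf (Submodule.span K (Set.range v)) ∧
      ∀ (m : ℕ) (L : E →ₗ[K] (Fin m → K)), Function.Surjective L →
        LinearMap.ker L = Submodule.span K (Set.range v) →
        AlgebraicIndependent K fun j => lf (LinearMap.proj j ∘ₗ L) := by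
  classical
  let P : ℕ → Prop := fun k => ∃ v : Fin k → E, LinearIndependent K v ∧ (∀ i, v i ∈ V) ∧
      AlgebraicOverForms lf (Submodule.span K (Set.range v))
  have h0 : P 0 := by
    refine ⟨Fin.elim0, linearIndependent_empty_type, fun i => i.elim0, ?_⟩
    have hr : Set.range (Fin.elim0 : Fin 0 → E) = ∅ := Set.range_eq_empty _
    rw [AlgebraicOverForms, hr, Submodule.span_empty, Submodule.dualAnnihilator_bot,
      Submodule.top_coe, Set.image_univ, hlf]
    exact ⟨fun x => isAlgebraic_algebraMap (⟨x, trivial⟩ : (⊤ : Subalgebra K A))⟩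
  have hbd : ∀ k, P k → k ≤ Module.finrank K E := fun k ⟨v, hv, _⟩ => by
    simpa using hv.fintype_card_le_finrank
  -- A family of maximal length: a remaining algebraic relation would allow one more point.
  obtain ⟨v, hv, hvV, halg⟩ := Nat.findGreatest_spec (P := P) (Nat.zero_le _) h0
  refine ⟨_, v, hv, hvV, halg, fun m L hL hker => ?_⟩
  by_contra hind
  obtain ⟨w, hwV, hw, hw'⟩ := halg.exists_sup hV hL hker hind
  have hP : P (Nat.findGreatest P (Module.finrank K E) + 1) := by
    refine ⟨Fin.cons w v, linearIndependent_finCons.2 ⟨hv, hw⟩, fun i => ?_, ?_⟩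
    · refine Fin.cases ?_ (fun i => ?_) i
      · exact hwV
      · exact hvV i
    · rwa [Fin.range_cons, Set.insert_eq, Submodule.span_union, sup_comm]
  exact absurd (Nat.le_findGreatest (hbd _ hP) hP) (by simp)

/-- Functionals that vanish on `ker L` factor through `L`, so the `m` coordinates of `L` already
generate the algebra of forms. -/
theorem AlgebraicOverForms.trdeg_le {lf : Module.Dual K E →ₗ[K] A} {W : Submodule K E}
    (hW : AlgebraicOverForms lf W) {m : ℕ} {L : E →ₗ[K] (Fin m → K)}
    (hker : LinearMap.ker L = W) : Algebra.trdeg K A ≤ m := by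
  set y : Fin m → A := fun j => lf (LinearMap.proj j ∘ₗ L) with hy
  have hsub : ∀ φ ∈ W.dualAnnihilator, lf φ ∈ Algebra.adjoin K (Set.range y) := fun φ hφ => by
    have hφ' : φ ∈ LinearMap.range L.dualMap := by
      rwa [LinearMap.range_dualMap_eq_dualAnnihilator_ker, hker]
    obtain ⟨χ, rfl⟩ := hφ'
    have : L.dualMap χ = ∑ j, χ (Pi.single j 1) • (LinearMap.proj j ∘ₗ L) := by
      ext u
      simp only [LinearMap.dualMap_apply, LinearMap.sum_apply, LinearMap.smul_apply,
        LinearMap.comp_apply, LinearMap.proj_apply, smul_eq_mul]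
      conv_lhs => rw [pi_eq_sum_univ' (L u), map_sum]
      refine Finset.sum_congr rfl fun j _ => ?_
      rw [map_smul, smul_eq_mul, mul_comm]
    rw [this, map_sum]
    refine sum_mem fun j _ => ?_
    rw [map_smul]
    exact Subalgebra.smul_mem _ (Algebra.subset_adjoin (Set.mem_range_self j)) _
  have : Algebra.IsAlgebraic (Algebra.adjoin K (Set.range y)) A := by
    refine isAlgebraic_adjoin_of_forall hW ?_
    rintro _ ⟨φ, hφ, rfl⟩
    exact isAlgebraic_algebraMap (⟨_, hsub φ hφ⟩ : Algebra.adjoin K (Set.range y))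
  refine (Algebra.IsAlgebraic.trdeg_le_cardinalMk K (Set.range y)).trans ?_
  simpa using Cardinal.mk_range_le_lift (f := y)

end Forms

/-! ### Dimension -/

theorem ringKrullDim_le_of_isIntegral {R A : Type*} [CommRing R] [CommRing A] [Algebra R A]
    [Algebra.IsIntegral R A] : ringKrullDim A ≤ ringKrullDim R :=
  Order.krullDim_le_of_strictMono (PrimeSpectrum.comap (algebraMap R A)) fun _ _ h =>
    Ideal.IsIntegral.comap_lt_comap h

/-- Noether normalization: `A` is integral over a polynomial ring whose number of variables is at
most the transcendence degree. -/
theorem ringKrullDim_le_of_trdeg_le {K A : Type*} [Field K] [CommRing A] [IsDomain A] [Algebra K A]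
    [Algebra.FiniteType K A] {m : ℕ} (h : Algebra.trdeg K A ≤ m) : ringKrullDim A ≤ m := by
  obtain ⟨s, g, hinj, hint⟩ := exists_integral_inj_algHom_of_fg K A
  algebraize [g.toRingHom]
  have hr : ringKrullDim (MvPolynomial (Fin s) K) = s := by
    rw [MvPolynomial.ringKrullDim_of_isNoetherianRing, ringKrullDim_eq_zero_of_field]
    simp
  have hd : ringKrullDim A ≤ ringKrullDim (MvPolynomial (Fin s) K) :=
    ringKrullDim_le_of_isIntegral
  refine hd.trans (hr.le.trans ?_)
  have hs : (s : Cardinal.{0}) ≤ m := by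
    have := lift_trdeg_le_of_injective g hinj
    rw [MvPolynomial.trdeg_of_isDomain] at this
    simpa using this.trans (Cardinal.lift_le.2 h)
  exact_mod_cast hs

section Proj

variable {n : ℕ}

theorem mem_idealOf {X : Set (RealProj n)} {f : MvPolynomial (Fin (n + 1)) ℝ} :
    f ∈ idealOf X ↔ ∀ x ∈ X, f ∈ x.asHomogeneousIdeal := by
  exact ProjectiveSpectrum.mem_vanishingIdeal _ _

theorem idealOf_isHomogeneous (X : Set (RealProj n)) :
    (idealOf X).IsHomogeneous (homogeneousSubmodule (Fin (n + 1)) ℝ) :=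
  (ProjectiveSpectrum.vanishingIdeal X).isHomogeneous

theorem mem_of_idealOf_le {X : Set (RealProj n)} (hX : IsClosed X) {x : RealProj n}
    (h : idealOf X ≤ x.asHomogeneousIdeal.toIdeal) : x ∈ X := by
  rw [← hX.closure_eq, ← ProjectiveSpectrum.zeroLocus_vanishingIdeal_eq_closure]
  exact h

theorem idealOf_anti {X Y : Set (RealProj n)} (h : X ⊆ Y) : idealOf Y ≤ idealOf X := fun _ hf =>
  mem_idealOf.2 fun x hx => mem_idealOf.1 hf x (h hx)

/-- Proj maps continuously to Spec, and `idealOf X` is the vanishing ideal of the irreducible image.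
-/
theorem idealOf_isPrime {X : Set (RealProj n)} (hX : IsIrreducible X) : (idealOf X).IsPrime := by
  let ι : RealProj n → PrimeSpectrum (MvPolynomial (Fin (n + 1)) ℝ) :=
    fun x => ⟨x.asHomogeneousIdeal.toIdeal, x.isPrime⟩
  have hι : Continuous ι := by
    rw [PrimeSpectrum.isTopologicalBasis_basic_opens.continuous_iff]
    rintro _ ⟨f, rfl⟩
    exact (ProjectiveSpectrum.basicOpen _ f).2
  have := PrimeSpectrum.isIrreducible_iff_vanishingIdeal_isPrime.1 (hX.image ι hι.continuousOn)
  have heq : idealOf X = PrimeSpectrum.vanishingIdeal (ι '' X) := Ideal.ext fun f => by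
    rw [mem_idealOf, PrimeSpectrum.mem_vanishingIdeal]
    simp [ι]
  rwa [heq]

/-- The dimension of a closed subset of projective space is smaller than that of its affine
cone. -/
theorem topologicalKrullDim_add_one_le {X : Set (RealProj n)} (hne : X.Nonempty) :
    topologicalKrullDim X + 1 ≤ ringKrullDim (CoordRing X) := by
  obtain ⟨x₀, hx₀⟩ := hne
  let img : TopologicalSpace.IrreducibleCloseds X → Set (RealProj n) := fun Z => (↑) '' (Z : Set X)
  have himg : ∀ Z, IsIrreducible (img Z) := fun Z =>
    Z.isIrreducible.image _ continuous_subtype_val.continuousOn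
  have hsub : ∀ Z, img Z ⊆ X := fun Z => by
    rintro _ ⟨y, -, rfl⟩
    exact y.2
  have himg_lt : ∀ Z₁ Z₂, Z₁ < Z₂ → idealOf (img Z₂) < idealOf (img Z₁) := fun Z₁ Z₂ h => by
    refine lt_of_le_not_ge (idealOf_anti (Set.image_mono h.le)) fun hle => h.not_ge fun y hy => ?_
    have hmem : (y : RealProj n) ∈ closure (img Z₁) := by
      refine mem_of_idealOf_le isClosed_closure ?_
      refine (idealOf_anti subset_closure).trans (hle.trans fun f hf => ?_)
      exact mem_idealOf.1 hf y ⟨y, hy, rfl⟩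
    rw [← closure_subtype, Z₁.isClosed.closure_eq] at hmem
    exact hmem
  -- The vertex of the cone: no point of Proj contains the irrelevant ideal, so `M` extends every
  -- chain of primes from `X` by one, which accounts for the `+ 1`.
  let M : Ideal (MvPolynomial (Fin (n + 1)) ℝ) := RingHom.ker (constantCoeff (R := ℝ))
  have hM : M.IsPrime := RingHom.ker_isPrime _
  have hltM : ∀ Y : Set (RealProj n), Y.Nonempty → idealOf Y < M := by
    rintro Y ⟨y, hy⟩
    refine lt_of_le_not_ge (fun f hf => ?_) fun hle => y.not_irrelevant_le ?_
    · have h0 := homogeneousComponent_mem_of_mem (idealOf_isHomogeneous Y) hf 0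
      have hc : C (constantCoeff f) ∈ y.asHomogeneousIdeal.toIdeal := by
        have := mem_idealOf.1 h0 y hy
        rwa [homogeneousComponent_zero] at this
      by_contra hne
      exact y.isPrime.ne_top (Ideal.eq_top_of_isUnit_mem _ hc ((isUnit_iff_ne_zero.2 hne).map C))
    · intro f hf
      refine mem_idealOf.1 (hle ?_) y hy
      have hf0 : homogeneousComponent 0 f = 0 :=
        (decomposition.decompose'_apply f 0).symm.trans
          ((HomogeneousIdeal.mem_irrelevant_iff _ _).1 hf)
      rw [homogeneousComponent_zero] at hf0
      exact C_injective _ _ (hf0.trans C_0.symm)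
  have hXM : ∀ Z, idealOf X ≤ idealOf (img Z) := fun Z => idealOf_anti (hsub Z)
  let F : WithTop (TopologicalSpace.IrreducibleCloseds X)ᵒᵈ →
      PrimeSpectrum.zeroLocus (idealOf X : Set (MvPolynomial (Fin (n + 1)) ℝ)) := fun Z =>
    match Z with
    | none => ⟨⟨M, hM⟩, (hltM X ⟨x₀, hx₀⟩).le⟩
    | some Z => ⟨⟨idealOf (img (OrderDual.ofDual Z)), idealOf_isPrime (himg _)⟩, hXM _⟩
  have hF : StrictMono F := by
    rw [WithTop.strictMono_iff]
    exact ⟨fun Z₁ Z₂ h => himg_lt _ _ h, fun Z => hltM _ (himg _).nonempty⟩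
  have : Nonempty (TopologicalSpace.IrreducibleCloseds X) :=
    ⟨⟨closure {⟨x₀, hx₀⟩}, isIrreducible_singleton.closure, isClosed_closure⟩⟩
  have hd := Order.krullDim_le_of_strictMono F hF
  rwa [Order.krullDim_WithTop, Order.krullDim_orderDual, ← ringKrullDim_quotient] at hd

end Proj

/-! ### Linear and quadratic forms -/

section Quadrics

variable {σ K : Type*} [Field K]

theorem eval_smul_of_isHomogeneous {f : MvPolynomial σ K} {d : ℕ} (hf : f.IsHomogeneous d) (c : K)
    (v : σ → K) : eval (c • v) f = c ^ d * eval v f := by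
  rw [eval_eq, eval_eq, Finset.mul_sum]
  refine Finset.sum_congr rfl fun m hm => ?_
  have hd : ∑ i ∈ m.support, m i = d := (hf.degree_eq_sum_deg_support hm).symm
  simp only [Pi.smul_apply, smul_eq_mul, mul_pow, Finset.prod_mul_distrib,
    Finset.prod_pow_eq_pow_sum, hd]
  ring

theorem mem_span_of_isHomogeneous_two {f : MvPolynomial σ K} (hf : f.IsHomogeneous 2) :
    f ∈ Submodule.span K (Set.range fun p : σ × σ => (X p.1 * X p.2 : MvPolynomial σ K)) := by
  rw [← mem_homogeneousSubmodule, ← homogeneousSubmodule_one_pow, pow_two,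
    homogeneousSubmodule_one_eq_span_X, Submodule.span_mul_span] at hf
  refine Submodule.span_mono ?_ hf
  rintro _ ⟨_, ⟨i, rfl⟩, _, ⟨j, rfl⟩, rfl⟩
  exact ⟨(i, j), rfl⟩

variable [Fintype σ]

theorem eval_add_of_isHomogeneous_two {f : MvPolynomial σ K} (hf : f.IsHomogeneous 2)
    (u v : σ → K) : eval (u + v) f = eval u f + eval u (dirDeriv v f) + eval v f := by
  have hspan := mem_span_of_isHomogeneous_two hf
  clear hf
  induction hspan using Submodule.span_induction with
  | mem x hx =>
    obtain ⟨⟨i, j⟩, rfl⟩ := hx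
    simp [Derivation.leibniz]
    ring
  | zero => simp
  | add a b _ _ ha hb => simp only [map_add, ha, hb]; ring
  | smul c a _ ha => simp only [Derivation.map_smul, smul_eval, ha]; ring

theorem eval_dirDeriv_self_of_isHomogeneous_two {f : MvPolynomial σ K} (hf : f.IsHomogeneous 2)
    (v : σ → K) : eval v (dirDeriv v f) = 2 * eval v f := by
  have hspan := mem_span_of_isHomogeneous_two hf
  clear hf
  induction hspan using Submodule.span_induction with
  | mem x hx =>
    obtain ⟨⟨i, j⟩, rfl⟩ := hx
    simp [Derivation.leibniz]
    ring
  | zero => simp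
  | add a b _ _ ha hb => simp only [map_add, ha, hb]; ring
  | smul c a _ ha => simp only [Derivation.map_smul, smul_eval, ha]; ring

/-- By Euler's formula `f` also vanishes at `v`, so Taylor expansion leaves only `eval u f`: the
quadric is a cone with vertex `v`. -/
theorem eval_add_of_dirDeriv_eq_zero [CharZero K] {f : MvPolynomial σ K} (hf : f.IsHomogeneous 2)
    {v : σ → K} (hv : dirDeriv v f = 0) (u : σ → K) : eval (u + v) f = eval u f := by
  have h1 := eval_add_of_isHomogeneous_two hf u v
  have h2 := eval_dirDeriv_self_of_isHomogeneous_two hf v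
  rw [hv, map_zero] at h1 h2
  have h3 : eval v f = 0 := by simpa using h2.symm
  rw [h1, h3]
  ring

variable [DecidableEq σ]

/-- The linear form `∑ φ(eᵢ) xᵢ` that represents the linear functional `φ`. -/
def linForm : Module.Dual K (σ → K) →ₗ[K] MvPolynomial σ K where
  toFun φ := ∑ i, φ (Pi.single i 1) • X i
  map_add' φ ψ := by simp [add_smul, Finset.sum_add_distrib]
  map_smul' c φ := by simp [mul_smul, Finset.smul_sum]

theorem linForm_apply (φ : Module.Dual K (σ → K)) :
    linForm φ = ∑ i, φ (Pi.single i 1) • (X i : MvPolynomial σ K) := rfl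

theorem linForm_isHomogeneous (φ : Module.Dual K (σ → K)) : (linForm φ).IsHomogeneous 1 :=
  (mem_homogeneousSubmodule _ _).1 <|
    Submodule.sum_mem _ fun i _ => Submodule.smul_mem _ _ (isHomogeneous_X K i)

@[simp]
theorem eval_linForm (v : σ → K) (φ : Module.Dual K (σ → K)) : eval v (linForm φ) = φ v := by
  conv_rhs => rw [pi_eq_sum_univ' v, map_sum]
  rw [linForm_apply, map_sum]
  refine Finset.sum_congr rfl fun i _ => ?_
  rw [smul_eval, eval_X, map_smul, smul_eq_mul, mul_comm]

@[simp]
theorem linForm_proj (i : σ) : linForm (LinearMap.proj i : (σ → K) →ₗ[K] K) = X i := by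
  rw [linForm_apply, Finset.sum_eq_single i]
  · simp
  · intro j _ hj
    simp [hj.symm]
  · simp

theorem exists_linForm_eq {f : MvPolynomial σ K} (hf : f.IsHomogeneous 1) :
    ∃ φ, linForm φ = f := by
  have h : f ∈ Submodule.span K (Set.range (X : σ → MvPolynomial σ K)) := by
    rwa [← homogeneousSubmodule_one_eq_span_X]
  refine (Submodule.span_le (p := LinearMap.range (linForm (σ := σ) (K := K)))).2 ?_ h
  rintro _ ⟨i, rfl⟩
  exact ⟨_, linForm_proj i⟩

theorem dirDeriv_linForm (v : σ → K) (φ : Module.Dual K (σ → K)) :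
    dirDeriv v (linForm φ) = C (φ v) := by
  rw [← eval_linForm, linForm_apply, map_sum, map_sum, map_sum]
  refine Finset.sum_congr rfl fun i _ => ?_
  rw [Derivation.map_smul, dirDeriv_X, smul_eval, eval_X, smul_eq_C_mul, C_mul]

theorem dirDeriv_linForm_sq_of_eq_zero {v : σ → K} {φ : Module.Dual K (σ → K)} (h : φ v = 0) :
    dirDeriv v (linForm φ ^ 2) = 0 := by
  rw [sq, Derivation.leibniz, dirDeriv_linForm, h]
  simp

/-- The pullback of polynomials along a linear map. -/
def pullback {m : ℕ} (L : (σ → K) →ₗ[K] (Fin m → K)) :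
    MvPolynomial (Fin m) K →ₐ[K] MvPolynomial σ K :=
  aeval fun j => linForm (LinearMap.proj j ∘ₗ L)

theorem eval_pullback {m : ℕ} (L : (σ → K) →ₗ[K] (Fin m → K)) (v : σ → K)
    (f : MvPolynomial (Fin m) K) : eval v (pullback L f) = eval (L v) f := by
  rw [pullback, ← coe_aeval_eq_eval v, RingHom.coe_coe, ← AlgHom.comp_apply, comp_aeval,
    ← coe_aeval_eq_eval (L v), RingHom.coe_coe]
  congr 2
  funext j
  exact eval_linForm _ _

theorem pullback_isHomogeneous {m d : ℕ} (L : (σ → K) →ₗ[K] (Fin m → K))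
    {f : MvPolynomial (Fin m) K} (hf : f.IsHomogeneous d) : (pullback L f).IsHomogeneous d := by
  have h := hf.aeval (fun j => linForm (LinearMap.proj j ∘ₗ L)) fun j => linForm_isHomogeneous _
  rwa [one_mul] at h

/-- If a family of operators that depends linearly on `v ∈ Kˢ` is injective for one `v`, then it is
injective off the zero set of a polynomial that does not vanish at `v`. -/
theorem exists_polynomial_injective {U M : Type*} [AddCommGroup U] [Module K U]
    [FiniteDimensional K U] [AddCommGroup M] [Module K M] (T : (σ → K) →ₗ[K] U →ₗ[K] M) {v : σ → K}
    (hv : Function.Injective (T v)) :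
    ∃ p : MvPolynomial σ K, eval v p ≠ 0 ∧ ∀ w, eval w p ≠ 0 → Function.Injective (T w) := by
  classical
  obtain ⟨ψ, hψ⟩ := (T v).exists_leftInverse_of_injective (LinearMap.ker_eq_bot.2 hv)
  let b := Module.finBasis K U
  -- `p` is `w ↦ det (ψ ∘ T w)`. Composing with the left inverse `ψ` of `T v` gives endomorphisms of
  -- `U`, with determinant `1` at `v`.
  let p : MvPolynomial σ K :=
    (∑ i, (X i : MvPolynomial σ K) • (LinearMap.toMatrix b b (ψ ∘ₗ T (Pi.single i 1))).map C).det
  have hp : ∀ w, eval w p = LinearMap.det (ψ ∘ₗ T w) := fun w => by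
    rw [← LinearMap.det_toMatrix b, RingHom.map_det]
    congr 1
    have hw : ψ ∘ₗ T w = ∑ i, w i • (ψ ∘ₗ T (Pi.single i 1)) := by
      conv_lhs => rw [pi_eq_sum_univ' w, map_sum]
      ext x
      simp [LinearMap.sum_apply]
    rw [hw]
    ext i j
    simp [Matrix.sum_apply, Matrix.smul_apply, RingHom.mapMatrix_apply, Matrix.map_apply]
  refine ⟨p, by rw [hp, hψ]; simp, fun w hw => ?_⟩
  rw [hp] at hw
  have := (LinearEquiv.ofIsUnitDet (f := ψ ∘ₗ T w) (v := b) (v' := b)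
    (by rw [LinearMap.det_toMatrix]; exact hw.isUnit)).injective
  exact Function.Injective.of_comp (f := ψ) this

end Quadrics

/-! ### Real and complex points -/

section Points

variable {n : ℕ} {X : Set (RealProj n)}

/-- The real vectors that represent the real points of `X`. -/
def realCone (X : Set (RealProj n)) : Set (Fin (n + 1) → ℝ) :=
  {v | v ≠ 0 ∧ ∀ f ∈ idealOf X, eval v f = 0}

/-- A real vector as a complex vector. -/
def complexify {σ : Type*} (v : σ → ℝ) : σ → ℂ := algebraMap ℝ ℂ ∘ v

theorem complexify_ne_zero {σ : Type*} {v : σ → ℝ} (hv : v ≠ 0) : complexify v ≠ 0 := by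
  obtain ⟨i, hi⟩ := Function.ne_iff.1 hv
  exact Function.ne_iff.2 ⟨i, by simpa [complexify] using hi⟩

theorem aeval_complexify {σ : Type*} (v : σ → ℝ) (f : MvPolynomial σ ℝ) :
    aeval (complexify v) f = algebraMap ℝ ℂ (eval v f) :=
  aeval_algebraMap_apply ℂ v f

theorem eval_map_eq_aeval {σ : Type*} (z : σ → ℂ) (f : MvPolynomial σ ℝ) :
    eval z (map (algebraMap ℝ ℂ) f) = aeval z f := by
  rw [eval_map, aeval_def]

theorem eval_map_complexify {σ : Type*} (v : σ → ℝ) (f : MvPolynomial σ ℝ) :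
    eval (complexify v) (map (algebraMap ℝ ℂ) f) = algebraMap ℝ ℂ (eval v f) := by
  rw [eval_map_eq_aeval, aeval_complexify]

theorem aeval_smul_of_isHomogeneous {σ : Type*} {f : MvPolynomial σ ℝ} {d : ℕ}
    (hf : f.IsHomogeneous d) (c : ℂ) (z : σ → ℂ) : aeval (c • z) f = c ^ d * aeval z f := by
  rw [← eval_map_eq_aeval, ← eval_map_eq_aeval, eval_smul_of_isHomogeneous (hf.map _)]

theorem aeval_smul_eq_zero {z : Fin (n + 1) → ℂ} (hz : ∀ f ∈ idealOf X, aeval z f = 0) (c : ℂ) :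
    ∀ f ∈ idealOf X, aeval (c • z) f = 0 := fun f hf => by
  rw [← sum_homogeneousComponent f, map_sum]
  refine Finset.sum_eq_zero fun d _ => ?_
  rw [aeval_smul_of_isHomogeneous (homogeneousComponent_isHomogeneous d f),
    hz _ (homogeneousComponent_mem_of_mem (idealOf_isHomogeneous X) hf d), mul_zero]

theorem mk_mem_complexPoints {z : Fin (n + 1) → ℂ} (hz : z ≠ 0) :
    Projectivization.mk ℂ z hz ∈ complexPoints X ↔ ∀ f ∈ idealOf X, aeval z f = 0 := by
  obtain ⟨a, ha⟩ := Projectivization.exists_smul_eq_mk_rep ℂ z hz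
  simp only [complexPoints, Set.mem_ofPred_eq, ← ha]
  refine ⟨fun h => ?_, fun h => aeval_smul_eq_zero h _⟩
  have := aeval_smul_eq_zero h (a⁻¹ : ℂˣ)
  rwa [← Units.smul_def, inv_smul_smul] at this

theorem mk_complexify_mem_realPoints {v : Fin (n + 1) → ℝ} (hv : v ∈ realCone X) :
    Projectivization.mk ℂ (complexify v) (complexify_ne_zero hv.1) ∈ realPoints X := by
  refine ⟨(mk_mem_complexPoints _).2 fun f hf => ?_, _, complexify_ne_zero hv.1,
    fun i => Complex.ofReal_im _, rfl⟩
  rw [aeval_complexify, hv.2 f hf, map_zero]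

theorem exists_realCone_of_mem_realPoints {z : Fin (n + 1) → ℂ} {hz : z ≠ 0}
    (h : Projectivization.mk ℂ z hz ∈ realPoints X) :
    ∃ v ∈ realCone X, ∃ c : ℂ, c ≠ 0 ∧ z = c • complexify v := by
  obtain ⟨hX, w, hw, hre, hmk⟩ := h
  rw [← hmk, mk_mem_complexPoints] at hX
  obtain ⟨a, ha⟩ := (Projectivization.mk_eq_mk_iff ℂ _ _ _ _).1 hmk
  have hwc : w = complexify fun i => (w i).re :=
    funext fun i => Complex.ext (by simp [complexify]) (by simp [complexify, hre i])
  refine ⟨fun i => (w i).re, ⟨fun h0 => hw ?_, fun f hf => ?_⟩, (a⁻¹ : ℂˣ), (a⁻¹).ne_zero, ?_⟩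
  · rw [hwc, h0]
    exact funext fun i => by simp [complexify]
  · have := hX f hf
    rw [hwc, aeval_complexify] at this
    exact (map_eq_zero_iff _ (algebraMap ℝ ℂ).injective).1 this
  · rw [← hwc, ← ha, ← Units.smul_def, inv_smul_smul]

/-- On a totally real variety, a complex polynomial that does not vanish at some complex point does
not vanish at some real point. -/
theorem IsTotallyReal.exists_realCone_eval_ne_zero (hX : IsTotallyReal X) {z : Fin (n + 1) → ℂ}
    {hz : z ≠ 0} (hzX : Projectivization.mk ℂ z hz ∈ complexPoints X)
    {p : MvPolynomial (Fin (n + 1)) ℂ} (hp : eval z p ≠ 0) :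
    ∃ v ∈ realCone X, ∃ c : ℂ, c ≠ 0 ∧ eval (c • complexify v) p ≠ 0 := by
  by_contra! hc
  refine hp (hX (fun w hw hwX => ?_) z hz hzX)
  obtain ⟨v, hv, c, hc0, rfl⟩ := exists_realCone_of_mem_realPoints hwX
  exact hc v hv c hc0

/-- A real form of positive degree that vanishes at the real points of a totally real variety
belongs to its ideal. -/
theorem IsTotallyReal.mem_idealOf (hX : IsTotallyReal X) (hprime : (idealOf X).IsPrime)
    {f : MvPolynomial (Fin (n + 1)) ℝ} {d : ℕ} (hf : f.IsHomogeneous d) (hd : d ≠ 0)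
    (h : ∀ v ∈ realCone X, eval v f = 0) : f ∈ idealOf X := by
  -- Nullstellensatz with complex zeros for the real prime ideal. The origin is among these zeros
  -- but is no point of `X(ℂ)`; positive degree handles it.
  rw [← MvPolynomial.IsPrime.vanishingIdeal_zeroLocus (K := ℂ) (idealOf X), mem_vanishingIdeal_iff]
  intro z hz
  by_contra hne
  by_cases hz0 : z = 0
  · refine hne ?_
    have := aeval_smul_of_isHomogeneous hf 0 z
    rwa [zero_smul, zero_pow hd, zero_mul, ← hz0] at this
  · rw [← eval_map_eq_aeval] at hne
    obtain ⟨v, hv, c, -, hvc⟩ := hX.exists_realCone_eval_ne_zero (hz := hz0)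
      ((mk_mem_complexPoints hz0).2 hz) hne
    rw [eval_smul_of_isHomogeneous (hf.map _), eval_map_complexify, h v hv] at hvc
    simp at hvc

theorem span_realCone_eq_top (hprime : (idealOf X).IsPrime) (hreal : IsTotallyReal X)
    (hnd : IsNondegenerate X) : Submodule.span ℝ (realCone X) = ⊤ := by
  by_contra hne
  obtain ⟨φ, hφ0, hφ⟩ := Submodule.exists_le_ker_of_lt_top _ (lt_top_iff_ne_top.2 hne)
  refine hnd (linForm φ) (linForm_isHomogeneous φ) (fun h0 => hφ0 ?_) ?_
  · refine LinearMap.ext fun v => ?_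
    rw [← eval_linForm, h0, map_zero, LinearMap.zero_apply]
  · have : linForm φ ∈ idealOf X :=
      hreal.mem_idealOf hprime (linForm_isHomogeneous φ) one_ne_zero fun v hv => by
        rw [eval_linForm]
        exact hφ (Submodule.subset_span hv)
    intro x hx
    rw [ProjectiveSpectrum.mem_zeroLocus, Set.singleton_subset_iff]
    exact PythagorasQP.mem_idealOf.1 this x hx

end Points

/-! ### Projection away from real points -/

theorem exists_surjective_ker_eq {K E : Type*} [Field K] [AddCommGroup E] [Module K E]
    [FiniteDimensional K E] (W : Submodule K E) :
    ∃ (m : ℕ) (L : E →ₗ[K] (Fin m → K)), Function.Surjective L ∧ LinearMap.ker L = W ∧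
      m + Module.finrank K W = Module.finrank K E := by
  refine ⟨Module.finrank K (E ⧸ W), (Module.finBasis K (E ⧸ W)).equivFun.toLinearMap ∘ₗ W.mkQ,
    ?_, ?_, Submodule.finrank_quotient_add_finrank W⟩
  · exact (Module.finBasis K (E ⧸ W)).equivFun.surjective.comp W.mkQ_surjective
  · rw [LinearEquiv.ker_comp, Submodule.ker_mkQ]

/-! ### Complexification of vectors, linear maps and quadratic forms -/

section Complexification

variable {ι κ : Type*}

theorem exists_eq_complexify_add (z : ι → ℂ) :
    ∃ a b : ι → ℝ, z = complexify a + Complex.I • complexify b :=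
  ⟨fun i => (z i).re, fun i => (z i).im, funext fun i => by
    simp only [complexify, Pi.add_apply, Pi.smul_apply, Function.comp_apply, smul_eq_mul,
      Complex.coe_algebraMap]
    rw [mul_comm, Complex.re_add_im]⟩

theorem complexify_add_eq_zero_iff {a b : ι → ℝ} :
    complexify a + Complex.I • complexify b = 0 ↔ a = 0 ∧ b = 0 := by
  refine ⟨fun h => ?_, ?_⟩
  · constructor <;> funext i
    · simpa [complexify] using congrArg Complex.re (congrFun h i)
    · simpa [complexify] using congrArg Complex.im (congrFun h i)
  · rintro ⟨rfl, rfl⟩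
    funext i
    simp [complexify]

theorem complexify_mem_span {v : κ → ι → ℝ} {a : ι → ℝ}
    (ha : a ∈ Submodule.span ℝ (Set.range v)) :
    complexify a ∈ Submodule.span ℂ (Set.range fun k => complexify (v k)) := by
  induction ha using Submodule.span_induction with
  | mem x hx =>
    obtain ⟨k, rfl⟩ := hx
    exact Submodule.subset_span ⟨k, rfl⟩
  | zero =>
    convert Submodule.zero_mem _
    funext i
    simp [complexify]
  | add x y _ _ hx hy =>
    convert Submodule.add_mem _ hx hy
    funext i
    simp [complexify]
  | smul c x _ hx =>
    convert Submodule.smul_mem _ (c : ℂ) hx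
    funext i
    simp [complexify]

theorem exists_map_add_of_isHomogeneous_two {f : MvPolynomial ι ℂ} (hf : f.IsHomogeneous 2) :
    ∃ g h : MvPolynomial ι ℝ, g.IsHomogeneous 2 ∧ h.IsHomogeneous 2 ∧
      f = map (algebraMap ℝ ℂ) g + Complex.I • map (algebraMap ℝ ℂ) h := by
  have hspan := mem_span_of_isHomogeneous_two hf
  clear hf
  induction hspan using Submodule.span_induction with
  | mem x hx =>
    obtain ⟨⟨i, j⟩, rfl⟩ := hx
    exact ⟨X i * X j, 0, (isHomogeneous_X ℝ i).mul (isHomogeneous_X ℝ j), isHomogeneous_zero _ _ _,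
      by simp⟩
  | zero => exact ⟨0, 0, isHomogeneous_zero _ _ _, isHomogeneous_zero _ _ _, by simp⟩
  | add a b _ _ ha hb =>
    obtain ⟨g, h, hg, hh, rfl⟩ := ha
    obtain ⟨g', h', hg', hh', rfl⟩ := hb
    refine ⟨g + g', h + h', hg.add hg', hh.add hh', ?_⟩
    simp only [map_add, smul_add]
    abel
  | smul c a _ ha =>
    obtain ⟨g, h, hg, hh, rfl⟩ := ha
    refine ⟨C c.re * g - C c.im * h, C c.re * h + C c.im * g, (hg.C_mul _).sub (hh.C_mul _),
      (hh.C_mul _).add (hg.C_mul _), ?_⟩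
    conv_lhs => rw [← Complex.re_add_im c]
    have hI : (C Complex.I * C Complex.I : MvPolynomial ι ℂ) = -1 := by
      rw [← C_mul, Complex.I_mul_I, C_neg, C_1]
    simp only [map_sub, map_add, map_mul, map_C, smul_eq_C_mul, Complex.coe_algebraMap]
    linear_combination (C (c.im : ℂ) * map (algebraMap ℝ ℂ) h) * hI

variable [Fintype ι] [DecidableEq ι]

/-- The complexification of a real linear map. -/
def complexifyMap {m : ℕ} (L : (ι → ℝ) →ₗ[ℝ] (Fin m → ℝ)) : (ι → ℂ) →ₗ[ℂ] (Fin m → ℂ) :=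
  Matrix.toLin' ((LinearMap.toMatrix' L).map (algebraMap ℝ ℂ))

theorem complexifyMap_complexify {m : ℕ} (L : (ι → ℝ) →ₗ[ℝ] (Fin m → ℝ)) (a : ι → ℝ) :
    complexifyMap L (complexify a) = complexify (L a) := by
  rw [complexifyMap, Matrix.toLin'_apply]
  funext i
  rw [complexify, ← RingHom.map_mulVec, LinearMap.toMatrix'_mulVec]
  rfl

theorem complexifyMap_surjective {m : ℕ} {L : (ι → ℝ) →ₗ[ℝ] (Fin m → ℝ)}
    (hL : Function.Surjective L) : Function.Surjective (complexifyMap L) := fun z => by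
  obtain ⟨a, b, rfl⟩ := exists_eq_complexify_add z
  obtain ⟨a, rfl⟩ := hL a
  obtain ⟨b, rfl⟩ := hL b
  exact ⟨complexify a + Complex.I • complexify b, by
    rw [map_add, map_smul, complexifyMap_complexify, complexifyMap_complexify]⟩

theorem ker_complexifyMap {m : ℕ} {L : (ι → ℝ) →ₗ[ℝ] (Fin m → ℝ)} {v : κ → ι → ℝ}
    (hL : LinearMap.ker L = Submodule.span ℝ (Set.range v)) :
    LinearMap.ker (complexifyMap L) = Submodule.span ℂ (Set.range fun k => complexify (v k)) := by
  refine le_antisymm (fun z hz => ?_) (Submodule.span_le.2 ?_)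
  · obtain ⟨a, b, rfl⟩ := exists_eq_complexify_add z
    rw [LinearMap.mem_ker, map_add, map_smul, complexifyMap_complexify, complexifyMap_complexify,
      complexify_add_eq_zero_iff, ← LinearMap.mem_ker, ← LinearMap.mem_ker, hL] at hz
    exact Submodule.add_mem _ (complexify_mem_span hz.1)
      (Submodule.smul_mem _ _ (complexify_mem_span hz.2))
  · rintro _ ⟨k, rfl⟩
    have hk : v k ∈ LinearMap.ker L := hL ▸ Submodule.subset_span ⟨k, rfl⟩
    rw [SetLike.mem_coe, LinearMap.mem_ker, complexifyMap_complexify, LinearMap.mem_ker.1 hk]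
    funext i
    simp [complexify]

end Complexification

/-! ### Upper bound for the quadratic persistence -/

section SecondInequality

variable {n : ℕ} {X : Set (RealProj n)}

/-- Successive projection applied to the real cone. The last clause says that the image of `X` lies
on no hypersurface. -/
theorem exists_real_projection (hprime : (idealOf X).IsPrime) (hreal : IsTotallyReal X)
    (hnd : IsNondegenerate X) :
    ∃ (k : ℕ) (v : Fin k → Fin (n + 1) → ℝ) (m : ℕ) (L : (Fin (n + 1) → ℝ) →ₗ[ℝ] (Fin m → ℝ)),
      (∀ i, v i ∈ realCone X) ∧ Function.Surjective L ∧
      LinearMap.ker L = Submodule.span ℝ (Set.range v) ∧ m + k = n + 1 ∧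
      ringKrullDim (CoordRing X) ≤ m ∧ ∀ q, pullback L q ∈ idealOf X → q = 0 := by
  let π := Ideal.Quotient.mkₐ ℝ (idealOf X)
  let lf : Module.Dual ℝ (Fin (n + 1) → ℝ) →ₗ[ℝ] CoordRing X := π.toLinearMap ∘ₗ linForm
  have hlf : Algebra.adjoin ℝ (Set.range lf) = ⊤ := by
    rw [eq_top_iff, ← (AlgHom.range_eq_top π).2 (Ideal.Quotient.mkₐ_surjective ℝ _),
      ← Algebra.map_top, ← adjoin_range_X, AlgHom.map_adjoin]
    refine Algebra.adjoin_mono ?_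
    rintro _ ⟨_, ⟨i, rfl⟩, rfl⟩
    exact ⟨LinearMap.proj i, by simp [lf]⟩
  obtain ⟨k, v, hv, hvX, halg, hind⟩ := exists_algebraicIndependent_forms lf hlf
    (span_realCone_eq_top hprime hreal hnd)
  obtain ⟨m, L, hL, hker, hm⟩ := exists_surjective_ker_eq (Submodule.span ℝ (Set.range v))
  refine ⟨k, v, m, L, hvX, hL, hker, ?_, ringKrullDim_le_of_trdeg_le (K := ℝ) (halg.trdeg_le hker),
    fun q hq => ?_⟩
  · rwa [finrank_span_eq_card hv, Fintype.card_fin, Module.finrank_fin_fun] at hm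
  · refine (injective_iff_map_eq_zero _).1 (hind m L hL hker) q ?_
    have : aeval (fun j => lf (LinearMap.proj j ∘ₗ L)) q = π (pullback L q) := by
      rw [pullback, ← AlgHom.comp_apply, comp_aeval]
      rfl
    rw [this]
    exact Ideal.Quotient.eq_zero_iff_mem.2 hq

theorem exists_quadraticPersistence_witness (hprime : (idealOf X).IsPrime) (hreal : IsTotallyReal X)
    {k m : ℕ} {v : Fin k → Fin (n + 1) → ℝ} {L : (Fin (n + 1) → ℝ) →ₗ[ℝ] (Fin m → ℝ)}
    (hv : ∀ i, v i ∈ realCone X) (hL : Function.Surjective L)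
    (hker : LinearMap.ker L = Submodule.span ℝ (Set.range v))
    (hq : ∀ q, pullback L q ∈ idealOf X → q = 0) :
    ∃ Γ : Finset (ℙ ℂ (Fin (n + 1) → ℂ)), (Γ : Set (ℙ ℂ (Fin (n + 1) → ℂ))) ⊆ complexPoints X ∧
      Γ.card ≤ k ∧ ∃ (m : ℕ) (L : (Fin (n + 1) → ℂ) →ₗ[ℂ] (Fin m → ℂ)), IsProjectionAway Γ L ∧
        ∀ f ∈ projIdeal (projImage L (complexPoints X)), f.IsHomogeneous 2 → f = 0 := by
  classical
  let P : Fin k → ℙ ℂ (Fin (n + 1) → ℂ) := fun i =>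
    Projectivization.mk ℂ (complexify (v i)) (complexify_ne_zero (hv i).1)
  refine ⟨Finset.univ.image P, ?_, Finset.card_image_le.trans (by simp), m, complexifyMap L,
    ⟨complexifyMap_surjective hL, ?_⟩, fun f hf hf2 => ?_⟩
  · rw [Finset.coe_image]
    rintro _ ⟨i, -, rfl⟩
    exact (mk_complexify_mem_realPoints (hv i)).1
  · rw [ker_complexifyMap hker, Submodule.span_range_eq_iSup, Finset.iSup_finset_image]
    simp [P, Projectivization.submodule_mk]
  · obtain ⟨g, h, hg, hh, rfl⟩ := exists_map_add_of_isHomogeneous_two hf2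
    have hgh : ∀ u ∈ realCone X, eval (L u) g = 0 ∧ eval (L u) h = 0 := fun u hu => by
      -- A point in the centre of projection has no image, but a quadratic form vanishes at `0`
      -- anyway.
      by_cases hLu : L u = 0
      · rw [hLu]
        have h0 : ∀ q : MvPolynomial (Fin m) ℝ, q.IsHomogeneous 2 → eval 0 q = 0 := fun q hq => by
          simpa using eval_smul_of_isHomogeneous hq 0 0
        exact ⟨h0 g hg, h0 h hh⟩
      · have hne : complexifyMap L (complexify u) ≠ 0 := by
          rw [complexifyMap_complexify]
          exact complexify_ne_zero hLu
        have := hf _ hne ⟨complexify u, complexify_ne_zero hu.1, hne,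
          (mk_complexify_mem_realPoints hu).1, rfl⟩
        rw [complexifyMap_complexify, map_add, smul_eval, eval_map_complexify,
          eval_map_complexify] at this
        exact ⟨by simpa using congrArg Complex.re this, by simpa using congrArg Complex.im this⟩
    have hmem : ∀ q : MvPolynomial (Fin m) ℝ, q.IsHomogeneous 2 →
        (∀ u ∈ realCone X, eval (L u) q = 0) → q = 0 := fun q hq2 h0 =>
      hq q <| hreal.mem_idealOf hprime (pullback_isHomogeneous L hq2) two_ne_zero fun u hu => by
        rw [eval_pullback, h0 u hu]
    rw [hmem g hg fun u hu => (hgh u hu).1, hmem h hh fun u hu => (hgh u hu).2]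
    simp

end SecondInequality

/-! ### Quadrics that are singular along points, and sums of squares -/

section FirstInequality

variable {n : ℕ} {X : Set (RealProj n)}

/-- If the projection of `Y` away from `Γ` lies on no quadric, then no quadric that contains `Y`
is singular along `Γ`. -/
theorem eq_zero_of_dirDeriv_eq_zero {Y : Set (ℙ ℂ (Fin (n + 1) → ℂ))}
    {Γ : Finset (ℙ ℂ (Fin (n + 1) → ℂ))} {m : ℕ} {L : (Fin (n + 1) → ℂ) →ₗ[ℂ] (Fin m → ℂ)}
    (hL : IsProjectionAway Γ L)
    (hq : ∀ f ∈ projIdeal (projImage L Y), f.IsHomogeneous 2 → f = 0)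
    {f : MvPolynomial (Fin (n + 1)) ℂ} (hf : f ∈ projIdeal Y) (hf2 : f.IsHomogeneous 2)
    (hΓ : ∀ p ∈ Γ, dirDeriv p.rep f = 0) : f = 0 := by
  have hker : ∀ v ∈ LinearMap.ker L, dirDeriv v f = 0 := fun v hv => by
    let S : Submodule ℂ (Fin (n + 1) → ℂ) :=
      { carrier := {v | dirDeriv v f = 0}
        add_mem' := fun {a b} (ha : _ = _) (hb : _ = _) =>
          show dirDeriv (a + b) f = 0 by rw [map_add, Derivation.add_apply, ha, hb, add_zero]
        zero_mem' := show dirDeriv 0 f = 0 by rw [map_zero, Derivation.zero_apply]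
        smul_mem' := fun c a (ha : _ = _) =>
          show dirDeriv (c • a) f = 0 by rw [map_smul, Derivation.smul_apply, ha, smul_zero] }
    have hS : ⨆ p ∈ Γ, p.submodule ≤ S := iSup₂_le fun p hp => by
      rw [Projectivization.submodule_eq, Submodule.span_singleton_le_iff_mem]
      exact hΓ p hp
    exact hS (hL.2 ▸ hv)
  -- Since `f` is constant along `ker L`, it descends to the target, where it is its pullback along
  -- any section `s`.
  obtain ⟨s, hs⟩ := L.exists_rightInverse_of_surjective (LinearMap.range_eq_top.2 hL.1)
  have hev : ∀ v, eval (L v) (pullback s f) = eval v f := fun v => by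
    rw [eval_pullback]
    have hmem : v - s (L v) ∈ LinearMap.ker L := by
      rw [LinearMap.mem_ker, map_sub, ← LinearMap.comp_apply L s, hs, LinearMap.id_apply, sub_self]
    have := eval_add_of_dirDeriv_eq_zero hf2 (hker _ hmem) (s (L v))
    rwa [add_sub_cancel, eq_comm] at this
  have h0 : pullback s f = 0 := by
    have hp2 := pullback_isHomogeneous s hf2
    refine hq _ ?_ hp2
    rintro w hw ⟨v, hv, hLv, hvY, hmk⟩
    obtain ⟨a, ha⟩ := (Projectivization.mk_eq_mk_iff ℂ _ _ _ _).1 hmk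
    have h1 : eval (L v) (pullback s f) = 0 := (hev v).trans (hf v hv hvY)
    rw [← ha, Units.smul_def, eval_smul_of_isHomogeneous hp2] at h1
    exact (mul_eq_zero.1 h1).resolve_left (pow_ne_zero _ a.ne_zero)
  exact MvPolynomial.funext fun v => by rw [← hev, h0, map_zero, map_zero]

/-- Complex points whose tangent conditions cut out zero can be moved to real points. -/
theorem IsTotallyReal.exists_real_tuple (hX : IsTotallyReal X) {k : ℕ}
    (U : Submodule ℂ (MvPolynomial (Fin (n + 1)) ℂ)) [FiniteDimensional ℂ U]
    (z : Fin k → Fin (n + 1) → ℂ)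
    (hz : ∀ i, ∃ h : z i ≠ 0, Projectivization.mk ℂ (z i) h ∈ complexPoints X)
    (hinj : ∀ f ∈ U, (∀ i, dirDeriv (z i) f = 0) → f = 0) :
    ∃ v : Fin k → Fin (n + 1) → ℝ, (∀ i, v i ∈ realCone X) ∧
      ∀ f ∈ U, (∀ i, dirDeriv (complexify (v i)) f = 0) → f = 0 := by
  induction k generalizing U with
  | zero => exact ⟨Fin.elim0, fun i => i.elim0, fun f hf _ => hinj f hf fun i => i.elim0⟩
  | succ k ih =>
    let D : (Fin (n + 1) → ℂ) → MvPolynomial (Fin (n + 1)) ℂ →ₗ[ℂ] MvPolynomial (Fin (n + 1)) ℂ :=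
      fun v => (dirDeriv v).toLinearMap
    have hD : ∀ v f, D v f = dirDeriv v f := fun _ _ => rfl
    -- Fixing the other points, the condition on the first one is that differentiation along it is
    -- injective on `U'`; this is open.
    let U' := U ⊓ ⨅ i : Fin k, LinearMap.ker (D (z i.succ))
    have hU' : FiniteDimensional ℂ U' := Submodule.finiteDimensional_of_le inf_le_left
    let T : (Fin (n + 1) → ℂ) →ₗ[ℂ] U' →ₗ[ℂ] MvPolynomial (Fin (n + 1)) ℂ :=
      LinearMap.mk₂ ℂ (fun v f => dirDeriv v (f : MvPolynomial (Fin (n + 1)) ℂ))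
        (by simp) (by simp) (by simp) (by simp)
    have hT : ∀ v f, T v f = dirDeriv v (f : MvPolynomial (Fin (n + 1)) ℂ) := fun _ _ => rfl
    have hT0 : Function.Injective (T (z 0)) := by
      rw [injective_iff_map_eq_zero]
      rintro ⟨f, hf⟩ h0
      rw [hT] at h0
      refine Subtype.ext (hinj f hf.1 (Fin.cases h0 fun i => ?_))
      exact (Submodule.mem_iInf _).1 hf.2 i
    obtain ⟨p, hp, hpT⟩ := exists_polynomial_injective T hT0
    obtain ⟨hz0, hzX⟩ := hz 0
    obtain ⟨w, hw, c, hc, hwp⟩ := hX.exists_realCone_eval_ne_zero hzX hp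
    -- The real point `w` now replaces `z 0`. Imposing its condition on `U` leaves an instance with
    -- one point fewer.
    have hTw := (injective_iff_map_eq_zero _).1 (hpT _ hwp)
    let U'' := U ⊓ LinearMap.ker (D (complexify w))
    have hU'' : FiniteDimensional ℂ U'' := Submodule.finiteDimensional_of_le inf_le_left
    obtain ⟨v, hv, hvinj⟩ := ih U'' (fun i => z i.succ) (fun i => hz i.succ) fun f hf hfz => by
      have := hTw ⟨f, hf.1, (Submodule.mem_iInf _).2 hfz⟩ (by
        rw [hT, map_smul, Derivation.smul_apply]
        have h2 : dirDeriv (complexify w) f = 0 := hf.2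
        rw [h2, smul_zero])
      exact congrArg Subtype.val this
    refine ⟨Fin.cons w v, Fin.cases hw hv, fun f hf h => hvinj f ⟨hf, h 0⟩ fun i => h i.succ⟩

theorem mem_gradedPiece {d : ℕ} {g : CoordRing X} : g ∈ gradedPiece X d ↔
    ∃ G : MvPolynomial (Fin (n + 1)) ℝ, G.IsHomogeneous d ∧ Ideal.Quotient.mk (idealOf X) G = g :=
  Iff.rfl

theorem sum_linForm_sq_isHomogeneous {s : ℕ} (φ : Fin s → Module.Dual ℝ (Fin (n + 1) → ℝ)) :
    (∑ i, linForm (φ i) ^ 2 : MvPolynomial (Fin (n + 1)) ℝ).IsHomogeneous 2 :=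
  IsHomogeneous.sum _ _ _ fun i _ => (linForm_isHomogeneous (φ i)).pow 2

/-- If no quadric that contains `X` is singular along `k` given real points, then some sum of
squares of linear forms needs at least `n + 1 - k` squares. -/
theorem le_add_of_forall_sosCone {k r : ℕ} {v : Fin k → Fin (n + 1) → ℝ}
    (hv : ∀ i, v i ∈ realCone X)
    (hsing : ∀ f ∈ idealOf X, f.IsHomogeneous 2 → (∀ i, dirDeriv (v i) f = 0) → f = 0)
    (hr : ∀ f ∈ sosCone X, ∃ g : Fin r → CoordRing X, (∀ i, g i ∈ gradedPiece X 1) ∧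
      f = ∑ i, g i ^ 2) : n + 1 ≤ r + k := by
  let W := Submodule.span ℝ (Set.range v)
  obtain ⟨s, L, -, hker, -⟩ := exists_surjective_ker_eq W
  let l : Fin s → Module.Dual ℝ (Fin (n + 1) → ℝ) := fun j => LinearMap.proj j ∘ₗ L
  let F : MvPolynomial (Fin (n + 1)) ℝ := ∑ j, linForm (l j) ^ 2
  obtain ⟨g, hg, hFg⟩ := hr (Ideal.Quotient.mk _ F)
    ⟨mem_gradedPiece.2 ⟨F, sum_linForm_sq_isHomogeneous l, rfl⟩, s,
      fun j => Ideal.Quotient.mk _ (linForm (l j)),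
      fun j => mem_gradedPiece.2 ⟨_, linForm_isHomogeneous _, rfl⟩, by simp [F]⟩
  have hφ : ∀ i, ∃ φ : Module.Dual ℝ (Fin (n + 1) → ℝ),
      Ideal.Quotient.mk (idealOf X) (linForm φ) = g i := fun i => by
    obtain ⟨G, hG, hGi⟩ := mem_gradedPiece.1 (hg i)
    obtain ⟨φ, rfl⟩ := exists_linForm_eq hG
    exact ⟨φ, hGi⟩
  choose φ hφ using hφ
  have hmem : F - ∑ i, linForm (φ i) ^ 2 ∈ idealOf X := by
    rw [← Ideal.Quotient.eq, hFg]
    simp [hφ]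
  have hlv : ∀ i j, l j (v i) = 0 := fun i j => by
    have : v i ∈ LinearMap.ker L := hker ▸ Submodule.subset_span ⟨i, rfl⟩
    simp [l, LinearMap.mem_ker.1 this]
  -- Here the points must be real: a sum of real squares is zero only if each term is.
  have hφv : ∀ i j, φ j (v i) = 0 := fun i j => by
    have h := (hv i).2 _ hmem
    simp only [F, map_sub, map_sum, map_pow, eval_linForm, hlv] at h
    have h' : ∑ j, φ j (v i) ^ 2 = 0 := by simpa using h
    exact pow_eq_zero_iff two_ne_zero |>.1
      ((Finset.sum_eq_zero_iff_of_nonneg fun j _ => sq_nonneg _).1 h' j (Finset.mem_univ j))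
  have heq : F - ∑ i, linForm (φ i) ^ 2 = 0 := by
    refine hsing _ hmem ((sum_linForm_sq_isHomogeneous l).sub (sum_linForm_sq_isHomogeneous φ))
      fun i => ?_
    rw [map_sub, map_sum, map_sum, Finset.sum_eq_zero fun j _ =>
      dirDeriv_linForm_sq_of_eq_zero (hlv i j), Finset.sum_eq_zero fun j _ =>
      dirDeriv_linForm_sq_of_eq_zero (hφv i j), sub_zero]
  let G : (Fin (n + 1) → ℝ) →ₗ[ℝ] (Fin r → ℝ) := LinearMap.pi φ
  have hGW : LinearMap.ker G ≤ W := fun u hu => by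
    have hu' : ∀ i, φ i u = 0 := fun i => congrFun (LinearMap.mem_ker.1 hu) i
    have h := congrArg (eval u) heq
    simp only [F, map_sub, map_sum, map_pow, eval_linForm, hu', map_zero] at h
    have h' : ∑ j, l j u ^ 2 = 0 := by simpa using h
    rw [← hker, LinearMap.mem_ker]
    exact funext fun j => pow_eq_zero_iff two_ne_zero |>.1
      ((Finset.sum_eq_zero_iff_of_nonneg fun j _ => sq_nonneg _).1 h' j (Finset.mem_univ j))
  have h1 := LinearMap.finrank_range_add_finrank_ker G
  have h2 := Submodule.finrank_mono hGW
  have h3 := (LinearMap.range G).finrank_le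
  have h4 := finrank_range_le_card (R := ℝ) v
  rw [Set.finrank, Fintype.card_fin] at h4
  rw [Module.finrank_fin_fun] at h1 h3
  change Module.finrank ℝ _ ≤ Module.finrank ℝ (Submodule.span ℝ (Set.range v)) at h2
  omega

open scoped MatrixOrder in
/-- Every sum of squares of linear forms is a sum of `n + 1` squares. -/
theorem exists_sum_sq_of_mem_sosCone {f : CoordRing X} (hf : f ∈ sosCone X) :
    ∃ g : Fin (n + 1) → CoordRing X, (∀ i, g i ∈ gradedPiece X 1) ∧ f = ∑ i, g i ^ 2 := by
  obtain ⟨-, r, g, hg, rfl⟩ := hf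
  have hφ : ∀ i, ∃ φ : Module.Dual ℝ (Fin (n + 1) → ℝ),
      Ideal.Quotient.mk (idealOf X) (linForm φ) = g i := fun i => by
    obtain ⟨G, hG, hGi⟩ := mem_gradedPiece.1 (hg i)
    obtain ⟨φ, rfl⟩ := exists_linForm_eq hG
    exact ⟨φ, hGi⟩
  choose φ hφ using hφ
  let M : Matrix (Fin r) (Fin (n + 1)) ℝ := LinearMap.toMatrix' (LinearMap.pi φ)
  -- The Gram matrix is positive semidefinite of size `n + 1`, so it factors through a square `B`,
  -- whose rows give `n + 1` linear forms.
  obtain ⟨B, hB⟩ := CStarAlgebra.nonneg_iff_eq_star_mul_self.1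
    (Matrix.posSemidef_conjTranspose_mul_self M).nonneg
  rw [Matrix.star_eq_conjTranspose] at hB
  let ψ : Fin (n + 1) → Module.Dual ℝ (Fin (n + 1) → ℝ) := fun i =>
    LinearMap.proj i ∘ₗ Matrix.toLin' B
  refine ⟨fun i => Ideal.Quotient.mk _ (linForm (ψ i)),
    fun i => mem_gradedPiece.2 ⟨_, linForm_isHomogeneous _, rfl⟩, ?_⟩
  have key : (∑ i, linForm (φ i) ^ 2 : MvPolynomial (Fin (n + 1)) ℝ) = ∑ i, linForm (ψ i) ^ 2 := by
    refine MvPolynomial.funext fun u => ?_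
    simp only [map_sum, map_pow, eval_linForm]
    have hM : ∀ {s : ℕ} (A : Matrix (Fin s) (Fin (n + 1)) ℝ),
        ∑ i, (A.mulVec u i) ^ 2 = u ⬝ᵥ ((A.conjTranspose * A).mulVec u) := fun A => by
      rw [← Matrix.mulVec_mulVec, Matrix.dotProduct_mulVec, Matrix.conjTranspose_eq_transpose_of_trivial,
        Matrix.vecMul_transpose, dotProduct]
      exact Finset.sum_congr rfl fun i _ => sq _
    have h1 : ∀ i, φ i u = M.mulVec u i := fun i => by
      rw [LinearMap.toMatrix'_mulVec, LinearMap.pi_apply]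
    have h2 : ∀ i, ψ i u = B.mulVec u i := fun i => by simp [ψ]
    simp only [h1, h2]
    rw [hM, hM, hB]
  simp only [← hφ, ← map_pow, ← map_sum, key]

end FirstInequality

/-! ### The two inequalities -/

section Main

variable {n : ℕ} {X : Set (RealProj n)}

/-- The Pythagoras number is attained. -/
theorem pythagorasNumber_spec (X : Set (RealProj n)) :
    ∀ f ∈ sosCone X, ∃ g : Fin (pythagorasNumber X) → CoordRing X,
      (∀ i, g i ∈ gradedPiece X 1) ∧ f = ∑ i, g i ^ 2 :=
  Nat.sInf_mem (s := {r : ℕ | ∀ f ∈ sosCone X,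
    ∃ g : Fin r → CoordRing X, (∀ i, g i ∈ gradedPiece X 1) ∧ f = ∑ i, g i ^ 2})
    -- The infimum of the empty set is `0`, so attainment needs this finite bound.
    ⟨n + 1, fun _ hf => exists_sum_sq_of_mem_sosCone hf⟩

/-- Points with a projection on no quadric bound the Pythagoras number from below. -/
theorem le_pythagorasNumber_add_card (hreal : IsTotallyReal X)
    {Γ : Finset (ℙ ℂ (Fin (n + 1) → ℂ))}
    (hΓ : (Γ : Set (ℙ ℂ (Fin (n + 1) → ℂ))) ⊆ complexPoints X) {m : ℕ}
    {L : (Fin (n + 1) → ℂ) →ₗ[ℂ] (Fin m → ℂ)} (hL : IsProjectionAway Γ L)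
    (hq : ∀ f ∈ projIdeal (projImage L (complexPoints X)), f.IsHomogeneous 2 → f = 0) :
    n + 1 ≤ pythagorasNumber X + Γ.card := by
  let Q := homogeneousSubmodule (Fin (n + 1)) ℂ 2
  have hQ : FiniteDimensional ℂ Q :=
    Module.Finite.iff_fg.2 (homogeneousSubmodule_fg _ _ 2)
  let U : Submodule ℂ (MvPolynomial (Fin (n + 1)) ℂ) :=
    (projIdeal (complexPoints X)).restrictScalars ℂ ⊓ Q
  have hU : FiniteDimensional ℂ U := Submodule.finiteDimensional_of_le inf_le_right
  obtain ⟨v, hv, hinj⟩ := hreal.exists_real_tuple U (fun i => (Γ.equivFin.symm i).1.rep)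
    (fun i => ⟨Projectivization.rep_nonzero _, by
      rw [Projectivization.mk_rep]
      exact hΓ (Γ.equivFin.symm i).2⟩)
    fun f hf h => eq_zero_of_dirDeriv_eq_zero hL hq hf.1 hf.2 fun p hp => by
      simpa using h (Γ.equivFin ⟨p, hp⟩)
  refine le_add_of_forall_sosCone hv (fun f hf hf2 h => ?_) (pythagorasNumber_spec X)
  refine map_injective _ (algebraMap ℝ ℂ).injective ?_
  rw [map_zero]
  refine hinj _ ⟨fun z hz hzX => ?_, hf2.map _⟩ fun i => ?_
  · rw [eval_map_eq_aeval]
    exact (mk_mem_complexPoints hz).1 hzX f hf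
  · have := congrArg (map (algebraMap ℝ ℂ)) (h i)
    rw [dirDeriv_apply, map_sum, map_zero] at this
    rw [dirDeriv_apply, ← this]
    refine Finset.sum_congr rfl fun j _ => ?_
    rw [pderiv_map, smul_eq_C_mul, smul_eq_C_mul, map_mul, map_C]
    rfl

end Main

end PythagorasQP

end

theorem theorem1p3 (n : ℕ) (X : Set (PythagorasQP.RealProj n)) (hclosed : IsClosed X)
    (hirr : IsIrreducible X) (hnd : PythagorasQP.IsNondegenerate X)
    (hreal : PythagorasQP.IsTotallyReal X) :
    ∃ d : ℕ, topologicalKrullDim X = (d : WithBot ℕ∞) ∧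
      (PythagorasQP.pythagorasNumber X : ℤ) ≥
        (n : ℤ) + 1 - (PythagorasQP.quadraticPersistence (PythagorasQP.complexPoints X) : ℤ) ∧
      (n : ℤ) + 1 - (PythagorasQP.quadraticPersistence (PythagorasQP.complexPoints X) : ℤ) ≥
        1 + (d : ℤ) := by
  have hprime := PythagorasQP.idealOf_isPrime hirr
  obtain ⟨k, v, m, L, hv, hL, hker, hmk, hdim, hq⟩ :=
    PythagorasQP.exists_real_projection hprime hreal hnd
  obtain ⟨Γ, hΓ, hΓk, hΓq⟩ :=
    PythagorasQP.exists_quadraticPersistence_witness hprime hreal hv hL hker hq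
  have hle : PythagorasQP.quadraticPersistence (PythagorasQP.complexPoints X) ≤ k :=
    le_trans (Nat.sInf_le (by exact ⟨Γ, hΓ, rfl, hΓq⟩)) hΓk
  -- The points `Γ` found for the other inequality show that the quadratic persistence is attained
  -- and not the default value `0`.
  obtain ⟨Γ', hΓ', hcard, m', L', hL', hq'⟩ := Nat.sInf_mem
    (s := {k : ℕ | ∃ Γ : Finset (ℙ ℂ (Fin (n + 1) → ℂ)),
      (Γ : Set (ℙ ℂ (Fin (n + 1) → ℂ))) ⊆ PythagorasQP.complexPoints X ∧ Γ.card = k ∧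
      ∃ (m : ℕ) (L : (Fin (n + 1) → ℂ) →ₗ[ℂ] (Fin m → ℂ)), PythagorasQP.IsProjectionAway Γ L ∧
        ∀ f ∈ PythagorasQP.projIdeal (PythagorasQP.projImage L (PythagorasQP.complexPoints X)),
          f.IsHomogeneous 2 → f = 0}) ⟨_, Γ, hΓ, rfl, hΓq⟩
  have hpy := PythagorasQP.le_pythagorasNumber_add_card hreal hΓ' hL' hq'
  rw [hcard] at hpy
  change n + 1 ≤ _ + PythagorasQP.quadraticPersistence (PythagorasQP.complexPoints X) at hpy
  have hd := (PythagorasQP.topologicalKrullDim_add_one_le hirr.nonempty).trans hdim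
  obtain ⟨x, hx⟩ := hirr.nonempty
  have : Nonempty (TopologicalSpace.IrreducibleCloseds X) :=
    ⟨⟨closure {⟨x, hx⟩}, isIrreducible_singleton.closure, isClosed_closure⟩⟩
  have hbot : topologicalKrullDim X ≠ ⊥ := Order.krullDim_ne_bot_iff.2 this
  obtain ⟨e, he⟩ := WithBot.ne_bot_iff_exists.1 hbot
  rw [← he] at hd
  have hd' : e + 1 ≤ m := by exact_mod_cast hd
  have htop : e ≠ ⊤ := by
    rintro rfl
    simp at hd'
  obtain ⟨d, rfl⟩ := ENat.ne_top_iff_exists.1 htop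
  have hdm : d + 1 ≤ m := by exact_mod_cast hd'
  exact ⟨d, he.symm, by omega, by omega⟩
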